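/- Let $d\ge 1$, let $\mathbb B=\{w\in\mathbb R^d:\|w\|\le 1\}$ be the Euclidean unit ball, and let $\mathcal W=\{x\mapsto\langle x,w\rangle : w\in\mathbb B\}$. For a probability distribution $D$ over $\mathbb R^d\times\{\pm1\}$ with marginal $D_X$ on $\mathbb R^d$, for $h:\mathbb R^d\to\mathbb R$ and $\gamma\ge 0$, let $\ell_\gamma(h,D)=\mathbb P_{(X,Y)\sim D}[Y h(X)\le\gamma]$ and $\ell^*_\gamma(D)=\inf_{h\in\mathcal W}\ell_\gamma(h,D)$. For a sample $S=((x_i,y_i))_{i=1}^m$ let $\ell_\gamma(h,S)=\frac1m|\{i: y_i h(x_i)\le\gamma\}|$. A learning algorithm is a function $A$ from $\bigcup_{m\ge1}(\mathbb R^d\times\{\pm1\})^m$ to the real-valued functions on $\mathbb R^d$; for $\delta\in(0,1)$ put $$\ell_0(A,D,m,\delta)=\inf\{\epsilon\ge0 : \mathbb P_{S\sim D^m}[\ell_0(A(S),D)\ge\epsilon]\le\delta\}.$$ A margin-error minimization (MEM) algorithm maps each $\gamma>0$ to a learning algorithm $A_\gamma$ such that $A_\gamma(S)\in\operatorname{argmin}_{h\in\mathcal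 W}\ell_\gamma(h,S)$ for every sample $S$. The sample complexity $m(\epsilon,\gamma,D,\delta)$ is the smallest $n\ge1$ such that $\ell_0(A_\gamma,D,m,\delta)-\ell^*_\gamma(D)\le\epsilon$ for every MEM algorithm $A$ and every $m\ge n$ (and $\infty$ if there is no such $n$). A real random variable $Z$ is sub-Gaussian with relative moment $\rho>0$ if $\mathbb E[\exp(tZ)]\le\exp(t^2\rho^2\,\mathbb E[Z^2]/2)$ for all $t\in\mathbb R$. A random vector $X\in\mathbb R^d$ is sub-Gaussian if there is a symmetric positive semidefinite matrix $B$ with $\mathbb E[\exp(\langle u,X\rangle)]\le\exp(\langle Bu,u\rangle/2)$ for all $u\in\mathbb R^d$. **Theorem.** There are absolute constants $\beta>0$ and $C\ge0$ such that for every integer $d>1$ there exist two probability distributions $D$ and $P$ over $\mathbb R^d\times\{\pm1\}$ such that: 1. $D_X$ and $P_X$ have identical covariance matrices; 2. $D_X$ and $P_X$ are laws of sub-Gaussian random vectors, and for every $u\in\mathbb R^d$ the variable $\langle u,X\rangle$ is sub-Gaussian with relative moment $\sqrt2$, both for $X\sim D_X$ and for $X\sim P_X$; 3. for all $\epsilon,\delta\in(0,\frac14)$,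 $$m(\epsilon,1,P,\delta)\ge\beta d-C \qquad\text{and}\qquad m(\epsilon,1,D,\delta)\le\lceil\log_2(1/\delta)\rceil .$$ -/

import Mathlib

open MeasureTheory ProbabilityTheory
open scoped ENNReal

noncomputable section

namespace MarginLearning

/-- The label set `{±1}`, realised as the units of `ℤ`. -/
abbrev Label : Type := ℤˣ

/-- A label as a real number. -/
def Label.toReal (y : Label) : ℝ := ((y : ℤ) : ℝ)

/-- The `γ`-margin error `ℙ_{(X,Y) ∼ D}[Y · h(X) ≤ γ]` of `h` on the distribution `D`.
For `γ = 0` it is the misclassification error. -/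
def marginLoss {X : Type*} [MeasurableSpace X] (γ : ℝ) (h : X → ℝ)
    (D : Measure (X × Label)) : ℝ :=
  D.real {z | Label.toReal z.2 * h z.1 ≤ γ}

/-- The best achievable `γ`-margin error on `D` over the hypothesis class `H`. -/
def bestMarginLoss {X : Type*} [MeasurableSpace X] (γ : ℝ) (H : Set (X → ℝ))
    (D : Measure (X × Label)) : ℝ :=
  sInf ((fun h => marginLoss γ h D) '' H)

/-- The `γ`-margin error of `h` on a labeled sample of size `m`. -/
def empiricalMarginLoss {X : Type*} {m : ℕ} (γ : ℝ) (h : X → ℝ)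
    (S : Fin m → X × Label) : ℝ :=
  (1 / (m : ℝ)) * (({i | Label.toReal (S i).2 * h (S i).1 ≤ γ} : Set (Fin m)).ncard : ℝ)

/-- A learning algorithm maps labeled samples to real valued functions on the domain.
Only its values on nonempty samples are ever used below. -/
abbrev LearningAlgorithm (X : Type*) : Type _ :=
  (m : ℕ) → (Fin m → X × Label) → (X → ℝ)

/-- The high-probability loss
`inf {ε ≥ 0 | ℙ_{S ∼ D^m}[ℓ₀(A(S), D) ≥ ε] ≤ δ}` of a learning algorithm. -/
def highProbLoss {X : Type*} [MeasurableSpace X] (A : LearningAlgorithm X)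
    (D : Measure (X × Label)) (m : ℕ) (δ : ℝ) : ℝ :=
  sInf {ε : ℝ | 0 ≤ ε ∧
    (Measure.pi (fun _ : Fin m => D)).real {S | ε ≤ marginLoss 0 (A m S) D} ≤ δ}

/-- `A` is a margin-error minimization (MEM) algorithm for the class `H`: for every margin
`γ > 0` and every nonempty sample `S`, the output `A γ S` is in `H` and minimizes the
`γ`-margin error on `S` over `H`. -/
def IsMEM {X : Type*} (H : Set (X → ℝ)) (A : ℝ → LearningAlgorithm X) : Prop :=
  ∀ γ : ℝ, 0 < γ → ∀ m : ℕ, 1 ≤ m → ∀ S : Fin m → X × Label,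
    A γ m S ∈ H ∧
      ∀ h ∈ H, empiricalMarginLoss γ (A γ m S) S ≤ empiricalMarginLoss γ h S

/-- The distribution-specific sample complexity `m(ε, γ, D, δ)` of MEM for the class `H`: the
least sample size `n ≥ 1` such that every MEM algorithm has high-probability excess loss at
most `ε` for all sample sizes `m ≥ n` (and `⊤` if there is no such `n`). -/
def sampleComplexity {X : Type*} [MeasurableSpace X] (H : Set (X → ℝ))
    (ε γ : ℝ) (D : Measure (X × Label)) (δ : ℝ) : ℕ∞ :=
  sInf ((fun n : ℕ => (n : ℕ∞)) '' {n : ℕ | 1 ≤ n ∧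
    ∀ A : ℝ → LearningAlgorithm X, IsMEM H A → ∀ m : ℕ, n ≤ m →
      highProbLoss (A γ) D m δ - bestMarginLoss γ H D ≤ ε})

/-- The class of homogeneous linear separators `x ↦ ⟨x, w⟩` with `‖w‖ ≤ 1`. -/
def linearClass (d : ℕ) : Set (EuclideanSpace ℝ (Fin d) → ℝ) :=
  {h | ∃ w : EuclideanSpace ℝ (Fin d), ‖w‖ ≤ 1 ∧ h = fun x => inner ℝ x w}

/-- The covariance matrix of a distribution over `ℝ^d`. -/
def covarianceMatrix {d : ℕ} (μ : Measure (EuclideanSpace ℝ (Fin d))) :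
    Matrix (Fin d) (Fin d) ℝ :=
  Matrix.of fun i j => cov[fun x => x i, fun x => x j; μ]

/-- `Z` is sub-Gaussian with moment `B ≥ 0`: for all real `t`, `exp (t Z)` is integrable and
`𝔼[exp (t Z)] ≤ exp (t² B² / 2)`. -/
def IsSubGaussian {Ω : Type*} [MeasurableSpace Ω] (μ : Measure Ω) (Z : Ω → ℝ) (B : ℝ) : Prop :=
  0 ≤ B ∧ ∀ t : ℝ, Integrable (fun ω => Real.exp (t * Z ω)) μ ∧
    ∫ ω, Real.exp (t * Z ω) ∂μ ≤ Real.exp (t ^ 2 * B ^ 2 / 2)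

/-- `Z` is sub-Gaussian with relative moment `ρ > 0`, i.e. with moment `ρ √(𝔼[Z²])`. -/
def HasRelativeMoment {Ω : Type*} [MeasurableSpace Ω] (μ : Measure Ω) (Z : Ω → ℝ)
    (ρ : ℝ) : Prop :=
  0 < ρ ∧ IsSubGaussian μ Z (ρ * Real.sqrt (∫ ω, Z ω ^ 2 ∂μ))

/-- `μ` is the law of a sub-Gaussian random vector with (symmetric positive semidefinite)
moment matrix `B`. -/
def IsSubGaussianVector {d : ℕ} (μ : Measure (EuclideanSpace ℝ (Fin d)))
    (B : Matrix (Fin d) (Fin d) ℝ) : Prop :=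
  B.PosSemidef ∧ ∀ u : EuclideanSpace ℝ (Fin d),
    Integrable (fun x => Real.exp (inner ℝ u x)) μ ∧
      ∫ x, Real.exp (inner ℝ u x) ∂μ ≤ Real.exp (inner ℝ (Matrix.toEuclideanLin B u) u / 2)

end MarginLearning

end

noncomputable section

namespace MarginLearning

/-! Both distributions live on vertices of boxes and are labeled by the sign of coordinate `0`,
whose half side `a` is just above `1`, so the first basis vector always separates with margin `a >
1`. Under `P` the other `d - 1` coordinates are independent signs times a large `b`. Under `D` a
fair bit decides whether these coordinates have size `√2 * b` or vanish; the covariance matrix is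
the same.

For `P`, take `d - 2` examples. With probability at least `1/2` their sign patterns off coordinate
`0` are linearly independent (`half_le_linearIndependent_tailSigns`), because a `k`-dimensional
subspace contains at most `2 ^ k` sign vectors (`ncard_signs_mem_le`). Then any labels are fitted by
a vector ignoring coordinate `0`, and large `b` brings it into the unit ball with margin above `1`
(`exists_fit_ignoring_zero`). An adversarial MEM algorithm may return it, although its true error is
at least `1/2` (`half_le_marginLoss`).

For `D`, a single example from the degenerate component forces any zero-loss `w` to satisfy `a * w 0
> 1`. As `‖w‖ ≤ 1` and `a` is close to `1`, the rest of `w` is too small to flip any sign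
(`margin_pos_of_one_lt`). Such an example is missed with probability only `2 ^ (-m)`.

Sub-Gaussianity comes from `cosh x ≤ exp (x ^ 2 / 2)`. -/

instance : DiscreteMeasurableSpace Label where
  forall_measurableSet s :=
    ⟨Units.val '' s, DiscreteMeasurableSpace.forall_measurableSet _,
      Set.preimage_image_eq s Units.val_injective⟩

lemma Label.toReal_mul_self (y : Label) : Label.toReal y * Label.toReal y = 1 := by
  rcases Int.units_eq_one_or y with rfl | rfl <;> norm_num [Label.toReal]

lemma Label.toReal_neg (y : Label) : Label.toReal (-y) = -Label.toReal y := by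
  simp [Label.toReal]

lemma Label.toReal_injective : Function.Injective Label.toReal := by
  intro x y h
  simpa [Label.toReal, Units.ext_iff] using h

lemma Label.toReal_ne_zero (y : Label) : Label.toReal y ≠ 0 := by
  intro h
  simpa [h] using y.toReal_mul_self

lemma Label.sum_univ (f : Label → ℝ) : ∑ y, f y = f 1 + f (-1) := by
  have : (Finset.univ : Finset Label) = {1, -1} := by decide
  rw [this, Finset.sum_pair (by decide)]

lemma Label.sum_exp_mul_toReal (u : ℝ) :
    ∑ y : Label, Real.exp (u * Label.toReal y) = 2 * Real.cosh u := by
  rw [Label.sum_univ, Real.cosh_eq]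
  simp [Label.toReal]
  ring

/-! ### Uniform measures on finite types as counting. -/

section Uniform

variable {Ω : Type*} [Fintype Ω] [MeasurableSpace Ω] [DiscreteMeasurableSpace Ω]

lemma uniformOn_univ_real (s : Set Ω) :
    (uniformOn (Set.univ : Set Ω)).real s = s.ncard / Fintype.card Ω := by
  rw [measureReal_def, uniformOn_univ, ENNReal.toReal_div, Measure.count_apply (.of_discrete),
    ← s.toFinite.cast_ncard_eq, ENat.toENNReal_coe, ENNReal.toReal_natCast,
    ENNReal.toReal_natCast]

lemma integral_uniformOn_univ [Nonempty Ω] (f : Ω → ℝ) :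
    ∫ ω, f ω ∂(uniformOn (Set.univ : Set Ω)) = (∑ ω, f ω) / Fintype.card Ω := by
  have : IsProbabilityMeasure (uniformOn (Set.univ : Set Ω)) :=
    isProbabilityMeasure_uniformOn Set.finite_univ Set.univ_nonempty
  rw [integral_fintype (.of_finite)]
  simp only [uniformOn_univ_real, Set.ncard_singleton, smul_eq_mul, Finset.sum_div]
  exact Finset.sum_congr rfl fun _ _ => by push_cast; ring

lemma pi_uniformOn_univ_real [Nonempty Ω] {m : ℕ} (s : Set (Fin m → Ω)) :
    (Measure.pi fun _ : Fin m => uniformOn (Set.univ : Set Ω)).real s =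
      s.ncard / (Fintype.card Ω : ℝ) ^ m := by
  classical
  have : IsProbabilityMeasure (uniformOn (Set.univ : Set Ω)) :=
    isProbabilityMeasure_uniformOn Set.finite_univ Set.univ_nonempty
  rw [← Set.coe_toFinset s, ← sum_measureReal_singleton, Set.ncard_coe_finset]
  simp [measureReal_def, Measure.pi_singleton, ENNReal.toReal_prod]
  simp only [← measureReal_def, uniformOn_univ_real]
  simp [div_eq_mul_inv]

end Uniform

/-- Sign patterns together with a bit that selects a component of a mixture. -/
abbrev BitSigns (n : ℕ) : Type := Bool × (Fin (n + 2) → Label)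

/-- The example with coordinates `c t i * σ i`, labeled by the sign `σ 0`. -/
def signExample {n : ℕ} (c : Bool → Fin (n + 2) → ℝ) (ω : BitSigns n) :
    EuclideanSpace ℝ (Fin (n + 2)) × Label :=
  (WithLp.toLp 2 fun i => c ω.1 i * Label.toReal (ω.2 i), ω.2 0)

/-- The balanced mixture over `t` of the uniform distributions on the vertices of the boxes with
half side lengths `c t i`, labeled by the sign of the coordinate `0`. -/
def signMixture {n : ℕ} (c : Bool → Fin (n + 2) → ℝ) :
    Measure (EuclideanSpace ℝ (Fin (n + 2)) × Label) :=
  (uniformOn (Set.univ : Set (BitSigns n))).map (signExample c)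

/-! ### Moments and sub-Gaussianity of the sign mixtures. -/

section SignMixture

variable {n : ℕ} (c : Bool → Fin (n + 2) → ℝ)

instance : IsProbabilityMeasure (uniformOn (Set.univ : Set (BitSigns n))) :=
  isProbabilityMeasure_uniformOn Set.finite_univ Set.univ_nonempty

lemma measurable_signExample : Measurable (signExample c) := .of_discrete

instance : IsProbabilityMeasure (signMixture c) :=
  Measure.isProbabilityMeasure_map (measurable_signExample c).aemeasurable

lemma signMixture_fst : (signMixture c).fst =
    (uniformOn (Set.univ : Set (BitSigns n))).map fun ω => (signExample c ω).1 := by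
  rw [Measure.fst, signMixture, Measure.map_map measurable_fst (measurable_signExample c)]
  rfl

lemma card_bitSigns : (Fintype.card (BitSigns n) : ℝ) = 2 * 2 ^ (n + 2) := by
  simp

instance : IsProbabilityMeasure (signMixture c).fst := by
  unfold Measure.fst
  exact Measure.isProbabilityMeasure_map measurable_fst.aemeasurable

lemma integral_signMixture_fst {f : EuclideanSpace ℝ (Fin (n + 2)) → ℝ} (hf : Measurable f) :
    ∫ x, f x ∂(signMixture c).fst =
      (∑ t : Bool, ∑ σ : Fin (n + 2) → Label, f (signExample c (t, σ)).1) /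
        (2 * 2 ^ (n + 2)) := by
  rw [signMixture_fst, integral_map (Measurable.of_discrete).aemeasurable
    hf.aestronglyMeasurable, integral_uniformOn_univ, card_bitSigns, Fintype.sum_prod_type]

lemma integrable_signMixture_fst {f : EuclideanSpace ℝ (Fin (n + 2)) → ℝ} (hf : Measurable f) :
    Integrable f (signMixture c).fst := by
  rw [signMixture_fst, integrable_map_measure hf.aestronglyMeasurable
    (Measurable.of_discrete).aemeasurable]
  exact .of_finite

lemma sum_eq_zero_of_flip (i : Fin (n + 2)) (f : (Fin (n + 2) → Label) → ℝ)
    (hf : ∀ σ, f (Function.update σ i (-σ i)) = -f σ) : ∑ σ, f σ = 0 := by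
  have h : ∑ σ, f (Function.update σ i (-σ i)) = ∑ σ, f σ :=
    Function.Involutive.bijective (f := fun σ => Function.update σ i (-σ i))
      (fun σ => by simp) |>.sum_comp f
  simp only [hf, Finset.sum_neg_distrib] at h
  linarith

lemma sum_sign (i : Fin (n + 2)) : ∑ σ : Fin (n + 2) → Label, Label.toReal (σ i) = 0 :=
  sum_eq_zero_of_flip i _ fun σ => by simp [Label.toReal_neg]

lemma sum_sign_mul_sign (i j : Fin (n + 2)) :
    ∑ σ : Fin (n + 2) → Label, Label.toReal (σ i) * Label.toReal (σ j) =
      if i = j then 2 ^ (n + 2) else 0 := by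
  split_ifs with h
  · subst h
    simp [Label.toReal_mul_self]
  · exact sum_eq_zero_of_flip i _ fun σ => by simp [Label.toReal_neg, Ne.symm h]

/-- The variance of the coordinate `i` under `signMixture c`. -/
def coordVariance (i : Fin (n + 2)) : ℝ := (c true i ^ 2 + c false i ^ 2) / 2

lemma integral_coord (i : Fin (n + 2)) : ∫ x, x i ∂(signMixture c).fst = 0 := by
  rw [integral_signMixture_fst c (by fun_prop)]
  simp [signExample, ← Finset.mul_sum, sum_sign]

lemma integral_coord_mul_coord (i j : Fin (n + 2)) :
    ∫ x, x i * x j ∂(signMixture c).fst = if i = j then coordVariance c i else 0 := by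
  rw [integral_signMixture_fst c (by fun_prop)]
  simp only [signExample, mul_mul_mul_comm, ← Finset.mul_sum, sum_sign_mul_sign]
  split_ifs with h
  · subst h
    simp only [Fintype.sum_bool, coordVariance]
    field_simp
  · simp

lemma covarianceMatrix_signMixture :
    covarianceMatrix (signMixture c).fst = Matrix.diagonal (coordVariance c) := by
  ext i j
  simp only [covarianceMatrix, Matrix.of_apply, covariance, integral_coord, sub_zero,
    integral_coord_mul_coord, Matrix.diagonal_apply]

lemma integral_inner_sq (u : EuclideanSpace ℝ (Fin (n + 2))) :
    ∫ x, (inner ℝ u x : ℝ) ^ 2 ∂(signMixture c).fst = ∑ i, coordVariance c i * u i ^ 2 := by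
  have h : ∀ x : EuclideanSpace ℝ (Fin (n + 2)),
      (inner ℝ u x : ℝ) ^ 2 = ∑ i, ∑ j, u i * u j * (x i * x j) := by
    intro x
    simp only [PiLp.inner_apply, sq, Finset.sum_mul_sum]
    refine Finset.sum_congr rfl fun i _ => Finset.sum_congr rfl fun j _ => ?_
    simp
    ring
  simp only [h]
  rw [integral_finsetSum _ fun i _ => integrable_signMixture_fst c (by fun_prop)]
  refine Finset.sum_congr rfl fun i _ => ?_
  rw [integral_finsetSum _ fun j _ => integrable_signMixture_fst c (by fun_prop)]
  simp only [integral_const_mul, integral_coord_mul_coord]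
  simp
  ring

lemma sum_exp_signs (v : Fin (n + 2) → ℝ) :
    ∑ σ : Fin (n + 2) → Label, Real.exp (∑ i, v i * Label.toReal (σ i)) =
      2 ^ (n + 2) * ∏ i, Real.cosh (v i) := by
  have h := Finset.prod_univ_sum (fun _ : Fin (n + 2) => (Finset.univ : Finset Label))
    (fun i y => Real.exp (v i * Label.toReal y))
  simp only [Label.sum_exp_mul_toReal, Fintype.piFinset_univ, Finset.prod_mul_distrib] at h
  simp only [Real.exp_sum, ← h]
  simp

lemma integral_exp_inner_le (u : EuclideanSpace ℝ (Fin (n + 2))) :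
    ∫ x, Real.exp (inner ℝ u x) ∂(signMixture c).fst ≤
      Real.exp (∑ i, coordVariance c i * u i ^ 2) := by
  rw [integral_signMixture_fst c (by fun_prop)]
  have h : ∀ t, ∑ σ : Fin (n + 2) → Label, Real.exp (inner ℝ u (signExample c (t, σ)).1) ≤
      2 ^ (n + 2) * Real.exp (∑ i, coordVariance c i * u i ^ 2) := by
    intro t
    have h1 : ∀ σ : Fin (n + 2) → Label, (inner ℝ u (signExample c (t, σ)).1 : ℝ) =
        ∑ i, (c t i * u i) * Label.toReal (σ i) := by
      intro σ
      simp only [PiLp.inner_apply, signExample]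
      refine Finset.sum_congr rfl fun i _ => ?_
      simp
      ring
    simp only [h1, sum_exp_signs]
    rw [Real.exp_sum]
    gcongr with i
    refine (Real.cosh_le_exp_half_sq _).trans (Real.exp_le_exp.2 ?_)
    -- A component's squared side is at most twice the average over the two components; this factor
    -- is the source of the relative moment `√2`.
    have : c t i ^ 2 ≤ 2 * coordVariance c i := by
      cases t <;> simp only [coordVariance] <;> nlinarith [sq_nonneg (c true i), sq_nonneg (c false i)]
    nlinarith [sq_nonneg (u i)]
  rw [div_le_iff₀ (by positivity), Fintype.sum_bool]
  linarith [h true, h false]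

lemma coordVariance_nonneg (i : Fin (n + 2)) : 0 ≤ coordVariance c i := by
  unfold coordVariance
  positivity

lemma isSubGaussianVector_signMixture :
    IsSubGaussianVector (signMixture c).fst (Matrix.diagonal fun i => 2 * coordVariance c i) := by
  refine ⟨Matrix.PosSemidef.diagonal fun i => by have := coordVariance_nonneg c i; simpa, fun u =>
    ⟨integrable_signMixture_fst c (by fun_prop), (integral_exp_inner_le c u).trans_eq ?_⟩⟩
  congr 1
  simp only [PiLp.inner_apply, Matrix.toLpLin_apply, Matrix.mulVec_diagonal, Finset.sum_div]
  refine Finset.sum_congr rfl fun i _ => ?_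
  simp
  ring

lemma hasRelativeMoment_signMixture (u : EuclideanSpace ℝ (Fin (n + 2))) :
    HasRelativeMoment (signMixture c).fst (fun x => inner ℝ u x) (Real.sqrt 2) := by
  refine ⟨by positivity, by positivity, fun t =>
    ⟨integrable_signMixture_fst c (by fun_prop), ?_⟩⟩
  have h := integral_exp_inner_le c (t • u)
  simp only [inner_smul_left] at h
  refine h.trans_eq ?_
  have h0 : 0 ≤ ∑ i, coordVariance c i * u i ^ 2 :=
    Finset.sum_nonneg fun i _ => mul_nonneg (coordVariance_nonneg c i) (sq_nonneg _)
  rw [integral_inner_sq, mul_pow, Real.sq_sqrt (by norm_num), Real.sq_sqrt h0]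
  congr 1
  simp only [Finset.mul_sum, Finset.sum_div]
  refine Finset.sum_congr rfl fun i _ => ?_
  simp
  ring

end SignMixture

/-! ### Linear independence of random sign vectors. -/

/-- The coordinate functionals restricted to `V` contain a basis of their span, of size at most
`finrank V`. The signs at these coordinates determine the whole vector. -/
lemma ncard_signs_mem_le {N : ℕ} (V : Submodule ℝ (Fin N → ℝ)) :
    {σ : Fin N → Label | (fun i => Label.toReal (σ i)) ∈ V}.ncard ≤ 2 ^ Module.finrank ℝ V := by
  classical
  let l : Fin N → Module.Dual ℝ V := fun i => (LinearMap.proj i).comp V.subtype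
  obtain ⟨f, hf, hspan, -⟩ := Submodule.exists_fun_fin_finrank_span_eq ℝ (Set.range l)
  choose k hk using hf
  have hinj : Set.InjOn (fun (σ : Fin N → Label) j => σ (k j))
      {σ | (fun i => Label.toReal (σ i)) ∈ V} := by
    intro σ hσ τ hτ h
    let v : V := ⟨_, hσ⟩ - ⟨_, hτ⟩
    -- The difference `v` of two vectors agreeing at the chosen coordinates is killed by a spanning
    -- family, hence by every coordinate functional.
    have hle : Submodule.span ℝ (Set.range l) ≤ LinearMap.ker (Module.Dual.eval ℝ V v) := by
      rw [← hspan, Submodule.span_le]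
      rintro _ ⟨j, rfl⟩
      have := congrFun h j
      simp only at this
      simp [← hk, l, v, this]
    funext i
    have := hle (Submodule.subset_span ⟨i, rfl⟩)
    simp [l, v, sub_eq_zero] at this
    exact Label.toReal_injective this
  calc _ ≤ (Set.univ : Set (Fin _ → Label)).ncard :=
        Set.ncard_le_ncard_of_injOn _ (fun _ _ => Set.mem_univ _) hinj
    _ = 2 ^ Module.finrank ℝ (Submodule.span ℝ (Set.range l)) := by simp [Set.ncard_univ]
    _ ≤ _ := by
        refine Nat.pow_le_pow_right two_pos ((Submodule.finrank_le _).trans ?_)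
        rw [Subspace.dual_finrank_eq]

/-- If subspaces of dimension `k` contain at most a fraction `2 ^ k / 2 ^ N` of the points `f ω`,
then at most a fraction `(2 ^ m - 1) / 2 ^ N` of the families of `m` points are dependent. -/
lemma ncard_linearDependent_le {Ω E : Type*} [Fintype Ω] [AddCommGroup E] [Module ℝ E]
    (f : Ω → E) (N : ℕ)
    (hf : ∀ V : Submodule ℝ E, Module.Finite ℝ V →
      2 ^ N * {ω | f ω ∈ V}.ncard ≤ 2 ^ Module.finrank ℝ V * Fintype.card Ω) (m : ℕ) :
    2 ^ N * {ω : Fin m → Ω | ¬ LinearIndependent ℝ (f ∘ ω)}.ncard + Fintype.card Ω ^ m ≤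
      2 ^ m * Fintype.card Ω ^ m := by
  classical
  induction m with
  | zero => simp
  | succ m ih =>
    let B := {ω : Fin m → Ω | ¬ LinearIndependent ℝ (f ∘ ω)}
    let V : (Fin m → Ω) → Submodule ℝ E := fun ω => Submodule.span ℝ (Set.range (f ∘ ω))
    -- The bad one-point extensions of a family: all points if it is already dependent, otherwise
    -- the points in its span. Summing the resulting bounds gives `1 + 2 + ... + 2 ^ (m - 1) = 2 ^ m
    -- - 1`.
    let T : (Fin m → Ω) → Finset Ω := fun ω => if ω ∈ B then Finset.univ else Finset.univ.filter fun x => f x ∈ V ω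
    have hsub : {ω : Fin (m + 1) → Ω | ¬ LinearIndependent ℝ (f ∘ ω)} ⊆
        (fun p : (_ : Fin m → Ω) × Ω => (Fin.cons p.2 p.1 : Fin (m + 1) → Ω)) ''
          ((Finset.univ : Finset (Fin m → Ω)).sigma T) := by
      intro ω hω
      refine ⟨⟨Fin.tail ω, ω 0⟩, ?_, by simp⟩
      simp only [Set.mem_ofPred_eq, linearIndependent_finSucc] at hω
      have htail : Fin.tail (f ∘ ω) = f ∘ Fin.tail ω := rfl
      rw [htail] at hω
      simp only [Finset.coe_sigma, Set.mem_sigma_iff, Finset.coe_univ, Set.mem_univ, true_and, T]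
      split_ifs with hB
      · simp
      · have hB' : LinearIndependent ℝ (f ∘ Fin.tail ω) := not_not.1 hB
        simpa [hB', V] using hω
    have hT : ∀ ω, 2 ^ N * (T ω).card ≤
        (if ω ∈ B then 2 ^ N * Fintype.card Ω else 0) + 2 ^ m * Fintype.card Ω := by
      intro ω
      simp only [T]
      split_ifs
      · simp
      · have h1 := hf (V ω) (Module.Finite.span_of_finite ℝ (Set.finite_range _))
        have h2 : Module.finrank ℝ (V ω) ≤ m :=
          (finrank_range_le_card (R := ℝ) (f ∘ ω)).trans_eq (Fintype.card_fin m)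
        rw [Set.ncard_eq_toFinset_card', Set.toFinset_ofPred] at h1
        rw [zero_add]
        exact h1.trans (Nat.mul_le_mul_right _ (Nat.pow_le_pow_right two_pos h2))
    have hcard : {ω : Fin (m + 1) → Ω | ¬ LinearIndependent ℝ (f ∘ ω)}.ncard ≤
        ∑ ω, (T ω).card := by
      rw [← Finset.card_sigma, ← Set.ncard_coe_finset]
      exact (Set.ncard_le_ncard hsub (Set.toFinite _)).trans (Set.ncard_image_le (Set.toFinite _))
    have hsum : 2 ^ N * ∑ ω, (T ω).card ≤
        B.ncard * (2 ^ N * Fintype.card Ω) + Fintype.card Ω ^ m * (2 ^ m * Fintype.card Ω) := by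
      rw [Finset.mul_sum]
      refine (Finset.sum_le_sum fun ω _ => hT ω).trans_eq ?_
      rw [Finset.sum_add_distrib, ← Finset.sum_filter, Set.filter_mem_univ_eq_toFinset,
        Finset.sum_const, Finset.sum_const, ← Set.ncard_eq_toFinset_card']
      simp
    have h3 := Nat.mul_le_mul_left (2 ^ N) hcard
    have h4 := Nat.mul_le_mul_right (Fintype.card Ω) ih
    change (2 ^ N * B.ncard + _) * _ ≤ _ at h4
    ring_nf at *
    linarith

/-- A linearly independent family admits a linear functional with prescribed values. -/
lemma exists_sum_mul_eq {m N : ℕ} {v : Fin m → Fin N → ℝ} (hv : LinearIndependent ℝ v)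
    (s : Fin m → ℝ) : ∃ w : Fin N → ℝ, ∀ i, ∑ j, v i j * w j = s i := by
  classical
  -- Independence gives a linear `g` sending each `v i` to the `i`-th basis vector; composing with
  -- the combination of the `s i` yields the functional `φ`.
  obtain ⟨g, hg⟩ := LinearMap.exists_leftInverse_of_injective (Fintype.linearCombination ℝ v)
    (LinearMap.ker_eq_bot.2 (linearIndependent_iff_injective_fintypeLinearCombination.1 hv))
  let φ : (Fin N → ℝ) →ₗ[ℝ] ℝ := (Fintype.linearCombination ℝ s).comp g
  refine ⟨fun j => φ (Pi.single j 1), fun i => ?_⟩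
  have h1 : g (v i) = Pi.single i 1 := by
    simpa using LinearMap.congr_fun hg (Pi.single i 1)
  have h2 : φ (v i) = s i := by simp [φ, h1]
  rw [← h2, LinearMap.pi_apply_eq_sum_univ φ (v i)]
  refine Finset.sum_congr rfl fun j _ => ?_
  have h3 : (Pi.single j 1 : Fin N → ℝ) = fun k => if j = k then 1 else 0 := by
    ext k
    simp [Pi.single_apply, eq_comm]
  rw [smul_eq_mul, ← h3]

/-! ### MEM algorithms and bounds on the high-probability loss. -/

/-- A MEM algorithm exists with outputs in prescribed sets of minimizers, where possible. -/
lemma exists_isMEM {X : Type*} {H : Set (X → ℝ)} (hH : H.Nonempty)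
    (Q : (m : ℕ) → (Fin m → X × Label) → (X → ℝ) → Prop) (γ : ℝ) :
    ∃ A : ℝ → LearningAlgorithm X, IsMEM H A ∧ ∀ m S,
      (∃ h ∈ H, empiricalMarginLoss γ h S = 0 ∧ Q m S h) → Q m S (A γ m S) := by
  classical
  have hnonneg : ∀ (γ : ℝ) (m : ℕ) (S : Fin m → X × Label) (h : X → ℝ),
      0 ≤ empiricalMarginLoss γ h S := fun γ m S h => by
    unfold empiricalMarginLoss
    positivity
  have key : ∀ (γ' : ℝ) (m : ℕ) (S : Fin m → X × Label), ∃ g, (g ∈ H ∧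
      ∀ h ∈ H, empiricalMarginLoss γ' g S ≤ empiricalMarginLoss γ' h S) ∧
      (γ' = γ → (∃ h ∈ H, empiricalMarginLoss γ h S = 0 ∧ Q m S h) → Q m S g) := by
    intro γ' m S
    -- A hypothesis with zero empirical loss is automatically a minimizer, so the preferred one may
    -- be returned. Otherwise any minimizer serves; one exists since error counts are natural
    -- numbers.
    by_cases hex : γ' = γ ∧ ∃ h ∈ H, empiricalMarginLoss γ h S = 0 ∧ Q m S h
    · obtain ⟨rfl, h, hh, h0, hQ⟩ := hex
      exact ⟨h, ⟨hh, fun g _ => h0.trans_le (hnonneg _ _ _ _)⟩, fun _ _ => hQ⟩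
    · obtain ⟨g, hg, hmin⟩ := WellFounded.has_min (measure fun h : X → ℝ =>
        ({i | Label.toReal (S i).2 * h (S i).1 ≤ γ'} : Set (Fin m)).ncard).wf H hH
      refine ⟨g, ⟨hg, fun h hh => ?_⟩, fun h1 h2 => absurd ⟨h1, h2⟩ hex⟩
      unfold empiricalMarginLoss
      exact mul_le_mul_of_nonneg_left (Nat.cast_le.2 (Nat.not_lt.1 (hmin h hh))) (by positivity)
  choose A hA hQ using key
  exact ⟨A, fun γ _ m _ S => hA γ m S, fun m S => hQ γ m S rfl⟩

lemma empiricalMarginLoss_eq_zero_iff {X : Type*} {m : ℕ} (γ : ℝ) (h : X → ℝ)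
    (S : Fin m → X × Label) :
    empiricalMarginLoss γ h S = 0 ↔ ∀ i, γ < Label.toReal (S i).2 * h (S i).1 := by
  rcases m.eq_zero_or_pos with rfl | hm
  · simp [empiricalMarginLoss]
  · simp [empiricalMarginLoss, Set.ncard_eq_zero (Set.toFinite _),
      Set.eq_empty_iff_forall_notMem, hm.ne']

lemma bestMarginLoss_nonneg {X : Type*} [MeasurableSpace X] (γ : ℝ) (H : Set (X → ℝ))
    (D : Measure (X × Label)) : 0 ≤ bestMarginLoss γ H D :=
  Real.sInf_nonneg (by rintro _ ⟨h, -, rfl⟩; exact measureReal_nonneg)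

lemma bestMarginLoss_eq_zero {X : Type*} [MeasurableSpace X] {γ : ℝ} {H : Set (X → ℝ)}
    {D : Measure (X × Label)} {h : X → ℝ} (hh : h ∈ H) (h0 : marginLoss γ h D = 0) :
    bestMarginLoss γ H D = 0 :=
  le_antisymm (h0 ▸ csInf_le ⟨0, by rintro _ ⟨h, -, rfl⟩; exact measureReal_nonneg⟩ ⟨h, hh, rfl⟩)
    (bestMarginLoss_nonneg _ _ _)

/-- If a learning algorithm has no loss outside a set of samples of probability at most `δ`, then
its high-probability loss vanishes. -/
lemma highProbLoss_nonpos {X : Type*} [MeasurableSpace X] {A : LearningAlgorithm X}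
    {D : Measure (X × Label)} [IsProbabilityMeasure D] {m : ℕ} {δ : ℝ}
    (B : Set (Fin m → X × Label))
    (hB : (Measure.pi fun _ : Fin m => D).real B ≤ δ)
    (h : ∀ᵐ S ∂Measure.pi fun _ : Fin m => D, S ∉ B → marginLoss 0 (A m S) D = 0) :
    highProbLoss A D m δ ≤ 0 := by
  -- The value `ε = 0` need not be admissible, as the event `0 ≤ loss` always holds; every `ε > 0`
  -- is.
  refine le_of_forall_pos_le_add fun ε hε => ?_
  rw [zero_add]
  refine csInf_le ⟨0, fun _ hx => hx.1⟩ ⟨hε.le, le_trans ?_ hB⟩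
  refine ENNReal.toReal_mono (measure_ne_top _ _) (measure_mono_ae ?_)
  filter_upwards [h] with S hS hle
  by_contra hSB
  have h1 : ε ≤ marginLoss 0 (A m S) D := hle
  linarith [hS hSB]

/-- If a learning algorithm has loss at least `η` on a set of samples of probability more than
`δ`, then its high-probability loss is at least `η`. -/
lemma le_highProbLoss {X : Type*} [MeasurableSpace X] {A : LearningAlgorithm X}
    {D : Measure (X × Label)} [IsProbabilityMeasure D] {m : ℕ} {δ η : ℝ} (hδ : 0 ≤ δ)
    (G : Set (Fin m → X × Label))
    (hG : δ < (Measure.pi fun _ : Fin m => D).real G)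
    (h : ∀ S ∈ G, η ≤ marginLoss 0 (A m S) D) :
    η ≤ highProbLoss A D m δ := by
  -- The value `2` exceeds every loss, so its event is empty; this shows that the infimum is over a
  -- nonempty set.
  refine le_csInf ⟨2, by norm_num, ?_⟩ ?_
  · have : {S | (2 : ℝ) ≤ marginLoss 0 (A m S) D} = ∅ := by
      refine Set.eq_empty_iff_forall_notMem.2 fun S hS => ?_
      have h1 : marginLoss 0 (A m S) D ≤ 1 := measureReal_le_one
      have h2 : 2 ≤ marginLoss 0 (A m S) D := hS
      linarith
    simpa [this]
  · rintro ε ⟨-, hε⟩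
    by_contra! hlt
    refine hG.not_ge (le_trans (measureReal_mono fun S hS => ?_) hε)
    exact hlt.le.trans (h S hS)

/-! ### Margins of linear separators on sign mixtures. -/

section SignMixture

variable {n : ℕ} (c : Bool → Fin (n + 2) → ℝ)

lemma signMixture_real {s : Set (EuclideanSpace ℝ (Fin (n + 2)) × Label)} (hs : MeasurableSet s) :
    (signMixture c).real s = (signExample c ⁻¹' s).ncard / (2 * 2 ^ (n + 2)) := by
  rw [signMixture, map_measureReal_apply (measurable_signExample c) hs, uniformOn_univ_real,
    card_bitSigns]

lemma measurableSet_linear_margin (γ : ℝ) (w : EuclideanSpace ℝ (Fin (n + 2))) :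
    MeasurableSet {z : EuclideanSpace ℝ (Fin (n + 2)) × Label |
      Label.toReal z.2 * inner ℝ z.1 w ≤ γ} := by
  have h : Measurable Label.toReal := .of_discrete
  exact measurableSet_le ((h.comp measurable_snd).mul (by fun_prop)) measurable_const

/-- The margin of the linear separator `w` on an example. -/
lemma margin_signExample (w : EuclideanSpace ℝ (Fin (n + 2))) (ω : BitSigns n) :
    Label.toReal (signExample c ω).2 * inner ℝ (signExample c ω).1 w =
      c ω.1 0 * w 0 + Label.toReal (ω.2 0) *
        ∑ j : Fin (n + 1), c ω.1 j.succ * Label.toReal (ω.2 j.succ) * w j.succ := by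
  have h := Label.toReal_mul_self (ω.2 0)
  simp only [signExample, PiLp.inner_apply, Fin.sum_univ_succ (n := n + 1), mul_add]
  congr 1
  · simp
    linear_combination (w 0 * c ω.1 0) * h
  · congr 1
    refine Finset.sum_congr rfl fun j _ => ?_
    simp
    ring

lemma marginLoss_signMixture_eq_zero {γ : ℝ} {w : EuclideanSpace ℝ (Fin (n + 2))}
    (hw : ∀ ω, γ < Label.toReal (signExample c ω).2 * inner ℝ (signExample c ω).1 w) :
    marginLoss γ (fun x => inner ℝ x w) (signMixture c) = 0 := by
  rw [marginLoss, signMixture_real c (measurableSet_linear_margin γ w)]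
  have : signExample c ⁻¹' {z | Label.toReal z.2 * inner ℝ z.1 w ≤ γ} = ∅ :=
    Set.eq_empty_iff_forall_notMem.2 fun ω hω => (hw ω).not_ge hω
  simp [this]

/-- A linear separator that ignores the coordinate `0` errs on at least half of the examples. -/
lemma half_le_marginLoss {w : EuclideanSpace ℝ (Fin (n + 2))} (hw : w 0 = 0) :
    1 / 2 ≤ marginLoss 0 (fun x => inner ℝ x w) (signMixture c) := by
  rw [marginLoss, signMixture_real c (measurableSet_linear_margin 0 w)]
  set s := signExample c ⁻¹' {z | Label.toReal z.2 * inner ℝ z.1 w ≤ 0} with hs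
  have hmem : ∀ ω, ω ∈ s ↔ Label.toReal (ω.2 0) *
      ∑ j : Fin (n + 1), c ω.1 j.succ * Label.toReal (ω.2 j.succ) * w j.succ ≤ 0 := by
    intro ω
    have h := margin_signExample c w ω
    rw [hw, mul_zero, zero_add] at h
    rw [← h]
    rfl
  -- Flipping the sign of coordinate `0` flips the label and leaves the score unchanged, so it
  -- negates the margin and injects correct examples into errors.
  let flip : BitSigns n → BitSigns n := fun ω => (ω.1, Function.update ω.2 0 (-ω.2 0))
  have hflip : Function.Involutive flip := fun ω => by simp [flip]
  have hle : sᶜ.ncard ≤ s.ncard := by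
    refine Set.ncard_le_ncard_of_injOn flip (fun ω hω => ?_) hflip.injective.injOn
    rw [Set.mem_compl_iff, hmem, not_le] at hω
    rw [hmem]
    simp [flip, Label.toReal_neg, hω.le]
  have hadd : (s.ncard : ℝ) + sᶜ.ncard = 2 * 2 ^ (n + 2) := by
    rw [← card_bitSigns, ← Nat.card_eq_fintype_card]
    exact_mod_cast Set.ncard_add_ncard_compl s
  have hle' : (sᶜ.ncard : ℝ) ≤ s.ncard := by exact_mod_cast hle
  rw [le_div_iff₀ (by positivity)]
  linarith

lemma ae_mem_range_signExample : ∀ᵐ z ∂signMixture c, z ∈ Set.range (signExample c) := by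
  exact (ae_map_iff (p := (· ∈ Set.range (signExample c)))
    (measurable_signExample c).aemeasurable (Set.finite_range _).measurableSet).2
    (ae_of_all _ fun ω => ⟨ω, rfl⟩)

lemma ae_pi_mem_range_signExample (m : ℕ) :
    ∀ᵐ S ∂Measure.pi fun _ : Fin m => signMixture c, ∀ i, S i ∈ Set.range (signExample c) :=
  ae_all_iff.2 fun _ => Measure.tendsto_eval_ae_ae.eventually (ae_mem_range_signExample c)

lemma mem_linearClass {d : ℕ} {w : EuclideanSpace ℝ (Fin d)} (hw : ‖w‖ ≤ 1) :
    (fun x => inner ℝ x w) ∈ linearClass d :=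
  ⟨w, hw, rfl⟩

end SignMixture

/-! ### Lower bound for the box distribution. -/

section LowerBound

variable {n : ℕ}

/-- The signs of the coordinates other than `0`. -/
def tailSigns (ω : BitSigns n) : Fin (n + 1) → ℝ := fun j => Label.toReal (ω.2 j.succ)

/-- Samples of at most `n` examples have independent sign patterns in the last `n + 1` coordinates
with probability at least one half. -/
lemma half_le_linearIndependent_tailSigns :
    1 / 2 ≤ (Measure.pi fun _ : Fin n => uniformOn (Set.univ : Set (BitSigns n))).real
      {ω | LinearIndependent ℝ (tailSigns ∘ ω)} := by
  rw [pi_uniformOn_univ_real]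
  set G := {ω : Fin n → BitSigns n | LinearIndependent ℝ (tailSigns ∘ ω)}
  have hV : ∀ V : Submodule ℝ (Fin (n + 1) → ℝ), Module.Finite ℝ V →
      2 ^ (n + 1) * {ω : BitSigns n | tailSigns ω ∈ V}.ncard ≤
        2 ^ Module.finrank ℝ V * Fintype.card (BitSigns n) := by
    intro V _
    -- The component bit and the sign of coordinate `0` do not affect the tail: they only contribute
    -- a factor `4`, which cancels against the cardinality of `BitSigns n`.
    have h1 : {ω : BitSigns n | tailSigns ω ∈ V}.ncard ≤
        ((Set.univ : Set (Bool × Label)) ×ˢ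
          {σ : Fin (n + 1) → Label | (fun i => Label.toReal (σ i)) ∈ V}).ncard := by
      refine Set.ncard_le_ncard_of_injOn (fun ω => ((ω.1, ω.2 0), Fin.tail ω.2))
        (fun ω hω => ⟨Set.mem_univ _, hω⟩) (Function.Injective.injOn fun ω τ h => ?_)
      simp only [Prod.mk.injEq] at h
      refine Prod.ext h.1.1 ?_
      rw [← Fin.cons_self_tail ω.2, ← Fin.cons_self_tail τ.2, h.1.2, h.2]
    rw [Set.ncard_prod, Set.ncard_univ] at h1
    have h2 := ncard_signs_mem_le V
    have h3 : Nat.card (Bool × Label) = 4 := by simp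
    have h4 : Fintype.card (BitSigns n) = 4 * 2 ^ (n + 1) := by
      simp
      ring
    rw [h3] at h1
    rw [h4]
    calc _ ≤ 2 ^ (n + 1) * (4 * 2 ^ Module.finrank ℝ V) :=
          Nat.mul_le_mul_left _ (h1.trans (Nat.mul_le_mul_left _ h2))
      _ = _ := by ring
  -- With `n` vectors in dimension `n + 1`, the dependent fraction is at most `(2 ^ n - 1) / 2 ^ (n
  -- + 1) < 1 / 2`.
  have h := ncard_linearDependent_le tailSigns (n + 1) hV n
  have hadd : (G.ncard : ℝ) + Gᶜ.ncard = (Fintype.card (BitSigns n) : ℝ) ^ n := by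
    have := Set.ncard_add_ncard_compl G
    rw [Nat.card_eq_fintype_card, Fintype.card_fun, Fintype.card_fin] at this
    exact_mod_cast this
  change 2 ^ (n + 1) * Gᶜ.ncard + _ ≤ _ at h
  have h' : (2 : ℝ) ^ (n + 1) * Gᶜ.ncard + (Fintype.card (BitSigns n) : ℝ) ^ n ≤
      2 ^ n * (Fintype.card (BitSigns n) : ℝ) ^ n := by exact_mod_cast h
  have hpos : 0 < (Fintype.card (BitSigns n) : ℝ) ^ n := by
    rw [card_bitSigns]
    positivity
  rw [le_div_iff₀ hpos, ← hadd]
  rw [← hadd] at h' hpos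
  have h2 : (2 : ℝ) ^ n * (2 * Gᶜ.ncard) ≤ 2 ^ n * (G.ncard + Gᶜ.ncard) := by
    rw [pow_succ] at h'
    linarith
  linarith [le_of_mul_le_mul_left h2 (by positivity)]

/-- Half side lengths of a box: `a` for the coordinate `0` and `b` for the others. -/
def boxSides (a b : ℝ) : Fin (n + 2) → ℝ := Fin.cons a fun _ => b

lemma boxSides_one (a b : ℝ) : boxSides (n := n) a b 1 = b := rfl

/-- If `b` is large enough, then samples with independent tails are fitted with margin `1` by
separators that ignore the coordinate `0`. -/
lemma exists_fit_ignoring_zero (n : ℕ) : ∃ b : ℝ, 0 < b ∧ ∀ (a : ℝ) (ω : Fin n → BitSigns n),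
    LinearIndependent ℝ (tailSigns ∘ ω) →
      ∃ w : EuclideanSpace ℝ (Fin (n + 2)), ‖w‖ ≤ 1 ∧ w 0 = 0 ∧
        ∀ i, 1 < Label.toReal (signExample (fun _ => boxSides a b) (ω i)).2 *
          inner ℝ (signExample (fun _ => boxSides a b) (ω i)).1 w := by
  classical
  have h : ∀ ω : Fin n → BitSigns n, ∃ w : Fin (n + 1) → ℝ,
      LinearIndependent ℝ (tailSigns ∘ ω) →
        ∀ i, ∑ j, tailSigns (ω i) j * w j = Label.toReal ((ω i).2 0) := by
    intro ω
    by_cases hω : LinearIndependent ℝ (tailSigns ∘ ω)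
    · obtain ⟨w, hw⟩ := exists_sum_mul_eq hω fun i => Label.toReal ((ω i).2 0)
      exact ⟨w, fun _ => hw⟩
    · exact ⟨0, fun h => absurd h hω⟩
  choose w hw using h
  let W : (Fin n → BitSigns n) → EuclideanSpace ℝ (Fin (n + 2)) := fun ω =>
    WithLp.toLp 2 (Fin.cons 0 (w ω))
  set R := ∑ ω, ‖W ω‖ with hR
  have hR0 : 0 ≤ R := Finset.sum_nonneg fun _ _ => norm_nonneg _
  have hWR : ∀ ω, ‖W ω‖ ≤ R := fun ω =>
    Finset.single_le_sum (f := fun ω => ‖W ω‖) (fun _ _ => norm_nonneg _) (Finset.mem_univ ω)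
  -- There are finitely many sign samples, so `R` bounds all their fitting vectors. Scaling by `(R +
  -- 1)⁻¹` puts them in the unit ball, and `b = R + 2` leaves the margin `(R + 2) / (R + 1) > 1`. As
  -- coordinate `0` of the fit is zero, `b` does not depend on `a`.
  refine ⟨R + 2, by linarith, fun a ω hω => ⟨(R + 1)⁻¹ • W ω, ?_, by simp [W], fun i => ?_⟩⟩
  · rw [norm_smul, Real.norm_of_nonneg (by positivity), inv_mul_le_iff₀ (by linarith)]
    linarith [hWR ω]
  · have h1 : ∑ j : Fin (n + 1), boxSides a (R + 2) j.succ * Label.toReal ((ω i).2 j.succ) *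
        ((R + 1)⁻¹ • W ω) j.succ = (R + 2) * (R + 1)⁻¹ * Label.toReal ((ω i).2 0) := by
      rw [← hw ω hω i, Finset.mul_sum]
      refine Finset.sum_congr rfl fun j _ => ?_
      simp [boxSides, W, tailSigns]
      ring
    rw [margin_signExample, h1]
    have h2 : ((R + 1)⁻¹ • W ω) 0 = 0 := by simp [W]
    have h3 := Label.toReal_mul_self ((ω i).2 0)
    have h4 : 1 < (R + 2) * (R + 1)⁻¹ := by
      rw [← div_eq_mul_inv, one_lt_div (by linarith)]
      linarith
    rw [h2]
    linear_combination h4 - ((R + 2) * (R + 1)⁻¹) * h3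

lemma norm_single_zero_le : ‖(EuclideanSpace.single 0 1 : EuclideanSpace ℝ (Fin (n + 2)))‖ ≤ 1 := by
  simp

lemma margin_single_zero (c : Bool → Fin (n + 2) → ℝ) (ω : BitSigns n) :
    Label.toReal (signExample c ω).2 *
      inner ℝ (signExample c ω).1 (EuclideanSpace.single 0 1) = c ω.1 0 := by
  rw [margin_signExample]
  simp

/-- The adversarial MEM algorithm returns, whenever it can, a zero-empirical-loss hypothesis of true
error at least `1/2`, while the best margin loss is `0`. -/
lemma lt_sampleComplexity {a b : ℝ} (ha : 1 < a)
    (hfit : ∀ ω : Fin n → BitSigns n, LinearIndependent ℝ (tailSigns ∘ ω) →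
      ∃ w : EuclideanSpace ℝ (Fin (n + 2)), ‖w‖ ≤ 1 ∧ w 0 = 0 ∧
        ∀ i, 1 < Label.toReal (signExample (fun _ => boxSides a b) (ω i)).2 *
          inner ℝ (signExample (fun _ => boxSides a b) (ω i)).1 w)
    {ε δ : ℝ} (hε : ε < 1 / 2) (hδ0 : 0 ≤ δ) (hδ : δ < 1 / 2) :
    ((n + 1 : ℕ) : ℕ∞) ≤
      sampleComplexity (linearClass (n + 2)) ε 1 (signMixture fun _ => boxSides a b) δ := by
  set c : Bool → Fin (n + 2) → ℝ := fun _ => boxSides a b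
  refine le_sInf ?_
  rintro _ ⟨k, ⟨-, hk⟩, rfl⟩
  rw [Nat.cast_le]
  by_contra! hlt
  obtain ⟨A, hA, hAQ⟩ := exists_isMEM (H := linearClass (n + 2))
    ⟨_, mem_linearClass norm_single_zero_le⟩
    (fun m _ h => 1 / 2 ≤ marginLoss 0 h (signMixture c)) 1
  -- A candidate `k < n + 1` must guarantee success for all sizes from `k` on, in particular at size
  -- `n`.
  have hloss := hk A hA n (by omega)
  have hbest : bestMarginLoss 1 (linearClass (n + 2)) (signMixture c) = 0 :=
    bestMarginLoss_eq_zero (mem_linearClass norm_single_zero_le)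
      (marginLoss_signMixture_eq_zero c fun ω => by rw [margin_single_zero]; exact ha)
  have hhigh : 1 / 2 ≤ highProbLoss (A 1) (signMixture c) n δ := by
    refine le_highProbLoss hδ0
      ((fun ω i => signExample c (ω i)) '' {ω | LinearIndependent ℝ (tailSigns ∘ ω)}) ?_ ?_
    · refine lt_of_lt_of_le hδ (le_trans (half_le_linearIndependent_tailSigns (n := n)) ?_)
      -- The sample law is the image of the uniform law on sign samples. Examples do not determine
      -- the bit, so the event is an image, and its preimage only contains the good sign samples;
      -- the inequality suffices.
      have hmap := Measure.pi_map_pi (ι := Fin n)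
        (μ := fun _ => uniformOn (Set.univ : Set (BitSigns n))) (f := fun _ => signExample c)
        (hμ := fun _ => inferInstanceAs (SigmaFinite (signMixture c)))
        (fun _ => (measurable_signExample c).aemeasurable)
      change _ = Measure.pi fun _ => signMixture c at hmap
      rw [← hmap]
      refine ENNReal.toReal_mono (by rw [hmap]; exact measure_ne_top _ _) ?_
      exact (measure_mono (Set.subset_preimage_image _ _)).trans
        (Measure.le_map_apply (Measurable.of_discrete).aemeasurable _)
    · rintro _ ⟨ω, hω, rfl⟩
      obtain ⟨w, hw1, hw0, hw⟩ := hfit ω hω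
      exact hAQ n _ ⟨_, mem_linearClass hw1, (empiricalMarginLoss_eq_zero_iff _ _ _).2 hw,
        half_le_marginLoss c hw0⟩
  linarith

end LowerBound

/-! ### Upper bound for the mixture with a degenerate component. -/

section UpperBound

variable {n : ℕ}

/-- The half side lengths of a mixture of a box and of its section in the direction of the
coordinate `0`, with the same covariance matrix as the box `boxSides a b`. -/
def mixtureSides (a b : ℝ) (t : Bool) : Fin (n + 2) → ℝ :=
  boxSides a (if t then Real.sqrt 2 * b else 0)

lemma coordVariance_mixtureSides (a b : ℝ) :
    coordVariance (mixtureSides (n := n) a b) = coordVariance fun _ => boxSides a b := by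
  ext i
  refine Fin.cases ?_ (fun j => ?_) i
  · simp [coordVariance, mixtureSides, boxSides]
  · simp [coordVariance, mixtureSides, boxSides, mul_pow]

/-- A separator with margin above `1` in the direction of the coordinate `0` makes no errors, as
the other coordinates of its normal vector are small. -/
lemma margin_pos_of_one_lt {a b : ℝ} (ha : 1 < a)
    (hab : 2 * b ^ 2 * (n + 1) * (a ^ 2 - 1) ≤ 1)
    {w : EuclideanSpace ℝ (Fin (n + 2))} (hw : ‖w‖ ≤ 1) (hw0 : 1 < a * w 0) (ω : BitSigns n) :
    0 < Label.toReal (signExample (mixtureSides a b) ω).2 *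
      inner ℝ (signExample (mixtureSides a b) ω).1 w := by
  rw [margin_signExample]
  set c := mixtureSides (n := n) a b ω.1 with hc
  have hc0 : c 0 = a := by simp [hc, mixtureSides, boxSides]
  have hcs : ∀ j : Fin (n + 1), c j.succ ^ 2 ≤ 2 * b ^ 2 := by
    intro j
    cases ht : ω.1
    · simp [hc, mixtureSides, boxSides, ht]
      positivity
    · simp [hc, mixtureSides, boxSides, ht, mul_pow]
  set s := Label.toReal (ω.2 0)
  set T := ∑ j : Fin (n + 1), c j.succ * Label.toReal (ω.2 j.succ) * w j.succ
  have hs : s * s = 1 := Label.toReal_mul_self _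
  have hnorm : w 0 ^ 2 + ∑ j : Fin (n + 1), w j.succ ^ 2 ≤ 1 := by
    rw [← Fin.sum_univ_succ (n := n + 1) (fun i => w i ^ 2), ← EuclideanSpace.real_norm_sq_eq]
    exact pow_le_one₀ (norm_nonneg _) hw
  -- Cauchy–Schwarz bounds the contribution `T` of the other coordinates.
  have hT : T ^ 2 ≤ (2 * b ^ 2 * (n + 1)) * ∑ j : Fin (n + 1), w j.succ ^ 2 := by
    refine (Finset.sum_mul_sq_le_sq_mul_sq _ _ _).trans ?_
    gcongr
    calc ∑ j : Fin (n + 1), (c j.succ * Label.toReal (ω.2 j.succ)) ^ 2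
        ≤ ∑ _j : Fin (n + 1), 2 * b ^ 2 := by
          refine Finset.sum_le_sum fun j _ => ?_
          rw [mul_pow, sq (Label.toReal _), Label.toReal_mul_self, mul_one]
          exact hcs j
      _ = 2 * b ^ 2 * (n + 1) := by simp; ring
  have hT1 : T ^ 2 ≤ 1 := by
    -- The chain is `∑ w j.succ ^ 2 ≤ 1 - w 0 ^ 2 ≤ a ^ 2 - (a * w 0) ^ 2 < a ^ 2 - 1`.
    have h1 : ∑ j : Fin (n + 1), w j.succ ^ 2 ≤ a ^ 2 - 1 := by
      have h2 : 1 < (a * w 0) ^ 2 := one_lt_pow₀ hw0 two_ne_zero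
      have h3 : 1 - w 0 ^ 2 ≤ a ^ 2 * (1 - w 0 ^ 2) := by
        have : 0 ≤ 1 - w 0 ^ 2 := by
          linarith [Finset.sum_nonneg fun (j : Fin (n + 1)) (_ : j ∈ Finset.univ) =>
            sq_nonneg (w j.succ)]
        nlinarith [mul_nonneg this (sub_nonneg.2 (one_le_pow₀ ha.le : 1 ≤ a ^ 2))]
      nlinarith
    exact hT.trans ((mul_le_mul_of_nonneg_left h1 (by positivity)).trans hab)
  have hsT : (s * T) ^ 2 ≤ 1 ^ 2 := by
    rw [mul_pow, sq s, hs]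
    linarith
  have := (abs_le_of_sq_le_sq' hsT zero_le_one).1
  rw [hc0]
  linarith

/-- Coordinate `1` reveals the hidden fair bit: it vanishes exactly on the degenerate component. -/
lemma signMixture_mixtureSides_real {a b : ℝ} (hb : 0 < b) :
    (signMixture (mixtureSides (n := n) a b)).real {z | z.1 1 ≠ 0} = 1 / 2 := by
  rw [signMixture_real]
  · have h : signExample (mixtureSides (n := n) a b) ⁻¹' {z | z.1 1 ≠ 0} =
        {true} ×ˢ Set.univ := by
      ext ⟨t, σ⟩
      cases t <;> simp [signExample, mixtureSides, boxSides_one, hb.ne', Label.toReal_ne_zero]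
    rw [h, Set.ncard_prod, Set.ncard_singleton, Set.ncard_univ]
    simp
    field_simp
  · exact (measurableSet_singleton (0 : ℝ)).compl.preimage (by fun_prop)

lemma sampleComplexity_le {a b : ℝ} (ha : 1 < a) (hb : 0 < b)
    (hab : 2 * b ^ 2 * (n + 1) * (a ^ 2 - 1) ≤ 1)
    {ε δ : ℝ} (hε : 0 ≤ ε) (hδ0 : 0 < δ) (hδ : δ < 1) :
    sampleComplexity (linearClass (n + 2)) ε 1 (signMixture (mixtureSides a b)) δ ≤
      ((⌈Real.logb 2 (1 / δ)⌉₊ : ℕ) : ℕ∞) := by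
  set D := signMixture (mixtureSides (n := n) a b) with hD
  have h1δ : 1 < 1 / δ := (one_lt_div hδ0).2 hδ
  have hceil : 1 ≤ ⌈Real.logb 2 (1 / δ)⌉₊ :=
    Nat.one_le_ceil_iff.2 (Real.logb_pos one_lt_two h1δ)
  refine sInf_le ⟨_, ⟨hceil, fun A hA m hm => ?_⟩, rfl⟩
  have hhigh : highProbLoss (A 1) D m δ ≤ 0 := by
    -- The bad event is that no example comes from the degenerate component; it has probability `2 ^
    -- (-m) ≤ δ`.
    refine highProbLoss_nonpos (Set.univ.pi fun _ => {z | z.1 1 ≠ 0}) ?_ ?_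
    · rw [measureReal_def, Measure.pi_pi, ENNReal.toReal_prod]
      simp only [← measureReal_def, hD, signMixture_mixtureSides_real hb, Finset.prod_const,
        Finset.card_univ, Fintype.card_fin]
      have h2 : 1 / δ ≤ 2 ^ m := by
        rw [← Real.rpow_natCast, ← Real.logb_le_iff_le_rpow one_lt_two (by positivity)]
        exact (Nat.le_ceil _).trans (Nat.cast_le.2 hm)
      rw [div_pow, one_pow]
      exact (one_div_le (by positivity) hδ0).2 h2
    · filter_upwards [ae_pi_mem_range_signExample (mixtureSides a b) m] with S hS hSB
      obtain ⟨i, hi⟩ : ∃ i, (S i).1 1 = 0 := by simpa [Set.mem_pi] using hSB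
      obtain ⟨⟨w, hw, hAw⟩, hmin⟩ := hA 1 one_pos m (hceil.trans hm) S
      -- The first basis vector has margin `a > 1` on every example, so every minimizer has zero
      -- empirical loss.
      have hzero : empiricalMarginLoss 1 (A 1 m S) S = 0 := by
        refine le_antisymm ((hmin _ (mem_linearClass norm_single_zero_le)).trans_eq ?_) ?_
        · refine (empiricalMarginLoss_eq_zero_iff _ _ _).2 fun j => ?_
          obtain ⟨ω, hω⟩ := hS j
          rw [← hω, margin_single_zero]
          exact ha
        · unfold empiricalMarginLoss
          positivity
      have hfit := (empiricalMarginLoss_eq_zero_iff _ _ _).1 hzero i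
      obtain ⟨ω, hω⟩ := hS i
      rw [hAw] at hfit ⊢
      rw [← hω] at hfit hi
      have ht : ω.1 = false := by
        by_contra ht
        simp [signExample, mixtureSides, boxSides_one, hb.ne', Label.toReal_ne_zero, ht] at hi
      -- On a degenerate example only coordinate `0` contributes, so margin above `1` reads `1 < a *
      -- w 0`.
      rw [margin_signExample] at hfit
      simp only [ht, mixtureSides, boxSides, Fin.cons_zero, Fin.cons_succ, Bool.false_eq_true,
        if_false, zero_mul, Finset.sum_const_zero, mul_zero, add_zero] at hfit
      exact marginLoss_signMixture_eq_zero _ (margin_pos_of_one_lt ha hab hw hfit)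
  linarith [bestMarginLoss_nonneg 1 (linearClass (n + 2)) D]

end UpperBound

end MarginLearning

end

theorem mainTheorem8 :
    ∃ β C : ℝ, 0 < β ∧ 0 ≤ C ∧
      ∀ d : ℕ, 1 < d →
        ∃ D P : Measure (EuclideanSpace ℝ (Fin d) × MarginLearning.Label),
          IsProbabilityMeasure D ∧ IsProbabilityMeasure P ∧
          MarginLearning.covarianceMatrix D.fst = MarginLearning.covarianceMatrix P.fst ∧
          (∃ B, MarginLearning.IsSubGaussianVector D.fst B) ∧
          (∃ B, MarginLearning.IsSubGaussianVector P.fst B) ∧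
          (∀ u : EuclideanSpace ℝ (Fin d),
            MarginLearning.HasRelativeMoment D.fst (fun x => inner ℝ u x) (Real.sqrt 2)) ∧
          (∀ u : EuclideanSpace ℝ (Fin d),
            MarginLearning.HasRelativeMoment P.fst (fun x => inner ℝ u x) (Real.sqrt 2)) ∧
          ∀ ε δ : ℝ, 0 < ε → ε < 1 / 4 → 0 < δ → δ < 1 / 4 →
            ENNReal.ofReal (β * (d : ℝ) - C) ≤
              ((MarginLearning.sampleComplexity
                (MarginLearning.linearClass d) ε 1 P δ : ℕ∞) : ℝ≥0∞) ∧
            MarginLearning.sampleComplexity (MarginLearning.linearClass d) ε 1 D δ ≤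
              ((⌈Real.logb 2 (1 / δ)⌉₊ : ℕ) : ℕ∞) := by
  -- The lower bound obtained is `n + 1 = d - 1`, hence `β = C = 1`.
  refine ⟨1, 1, one_pos, zero_le_one, fun d hd => ?_⟩
  obtain ⟨n, rfl⟩ : ∃ n, d = n + 2 := ⟨d - 2, by omega⟩
  obtain ⟨b, hb, hfit⟩ := MarginLearning.exists_fit_ignoring_zero n
  have hκ : 0 < 2 * b ^ 2 * ((n : ℝ) + 1) := by positivity
  -- The choice of `a` comes after that of `b`: taking `a ^ 2 - 1` to be the inverse of `2 * b ^ 2 *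
  -- (n + 1)` makes the bound an equality.
  obtain ⟨a, ha, hab⟩ : ∃ a : ℝ, 1 < a ∧ 2 * b ^ 2 * ((n : ℝ) + 1) * (a ^ 2 - 1) ≤ 1 := by
    have h : 1 < 1 + (2 * b ^ 2 * ((n : ℝ) + 1))⁻¹ := by
      have := inv_pos.2 hκ
      linarith
    refine ⟨Real.sqrt (1 + (2 * b ^ 2 * ((n : ℝ) + 1))⁻¹), Real.lt_sqrt_of_sq_lt (by linarith), ?_⟩
    rw [Real.sq_sqrt (by linarith), add_sub_cancel_left, mul_inv_cancel₀ hκ.ne']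
  refine ⟨MarginLearning.signMixture (MarginLearning.mixtureSides a b),
    MarginLearning.signMixture fun _ => MarginLearning.boxSides a b, inferInstance, inferInstance,
    ?_, ⟨_, MarginLearning.isSubGaussianVector_signMixture _⟩,
    ⟨_, MarginLearning.isSubGaussianVector_signMixture _⟩,
    MarginLearning.hasRelativeMoment_signMixture _,
    MarginLearning.hasRelativeMoment_signMixture _, fun ε δ hε0 hε hδ0 hδ => ⟨?_, ?_⟩⟩
  · rw [MarginLearning.covarianceMatrix_signMixture, MarginLearning.covarianceMatrix_signMixture,
      MarginLearning.coordVariance_mixtureSides]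
  · have h := MarginLearning.lt_sampleComplexity ha (hfit a) (ε := ε) (δ := δ) (by linarith)
      hδ0.le (by linarith)
    have hcast : (1 : ℝ) * ((n + 2 : ℕ) : ℝ) - 1 = ((n + 1 : ℕ) : ℝ) := by
      push_cast
      ring
    rw [hcast, ENNReal.ofReal_natCast]
    simpa using ENat.toENNReal_le.2 h
  · exact MarginLearning.sampleComplexity_le ha hb hab hε0.le hδ0 (by linarith)
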